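/- Let $\mu>-1$, $q>-1$ and $0<\gamma<1$. For $\alpha>-1$ and $x>0$ let $I_\alpha(x)=\sum_{k\ge 0}\frac{(x/2)^{2k+\alpha}}{k!\,\Gamma(k+\alpha+1)}$ be the modified Bessel function of the first kind and $r_\alpha=I_{\alpha+1}/I_\alpha$. Define $$R(x)=R_{\mu,q,\gamma}(x)=\frac{\int_0^x e^{-\gamma t}t^{q-\mu}I_\mu(t)\,dt}{e^{-\gamma x}x^{q-\mu}I_{\mu+1}(x)}\quad(x>0),\qquad M^*=\sup_{x>0}R(x).$$ Then: (i) If $x_0>0$ and $R'(x_0)=0$, then $r_\mu(x_0)\{r_{\mu+1}(x_0)+(q+1)/x_0-\gamma\}\ne 0$ and $$R(x_0)=\frac{1}{r_\mu(x_0)\{r_{\mu+1}(x_0)+(q+1)/x_0-\gamma\}}.$$ (ii) $\lim_{x\downarrow 0}R(x)=\frac{2(\mu+1)}{q+1}$ and $\lim_{x\to\infty}R(x)=\frac1{1-\gamma}$; the constant $M^*$ is finite, and $$M^*=\max\left\{\frac{2(\mu+1)}{q+1},\ \frac{1}{1-\gamma},\ \sup_{x>0,\ R'(x)=0}\frac{1}{r_\mu(x)\{r_{\mu+1}(x)+(q+1)/x-\gamma\}}\right\},$$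 where the last entry (a finite supremum) is omitted if $R$ has no stationary point in $(0,\infty)$. -/

import Mathlib

open Filter Topology Set

noncomputable section

namespace BesselQuotient

/-- The modified Bessel function of the first kind of real order `α`, for `x > 0`, as the series
`∑ (x/2)^(2k+α) / (k! Γ(k+α+1))`. -/
def besselI (α x : ℝ) : ℝ :=
  ∑' k : ℕ, (x / 2) ^ (2 * (k : ℝ) + α) / ((k.factorial : ℝ) * Real.Gamma ((k : ℝ) + α + 1))

/-- The Bessel ratio `r_α = I_{α+1} / I_α`. -/
def ratio (α x : ℝ) : ℝ :=
  besselI (α + 1) x / besselI α x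

/-- The power-weighted quotient `R_{μ,q,γ}(x)`, for `x > 0`. -/
def R (μ q γ x : ℝ) : ℝ :=
  (∫ t in (0 : ℝ)..x, Real.exp (-γ * t) * t ^ (q - μ) * besselI μ t) /
    (Real.exp (-γ * x) * x ^ (q - μ) * besselI (μ + 1) x)

/-- The sharp endpoint constant `M* = sup_{x > 0} R_{μ,q,γ}(x)`. -/
def sharpConstant (μ q γ : ℝ) : ℝ :=
  sSup (R μ q γ '' Ioi 0)

/-- The points `x > 0` at which `R_{μ,q,γ}` is differentiable with derivative zero. -/
def stationaryPoints (μ q γ : ℝ) : Set ℝ :=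
  {x | 0 < x ∧ HasDerivAt (R μ q γ) 0 x}

/-- The product `r_μ(x) (r_{μ+1}(x) + (q+1)/x - γ)`. -/
def stationaryDenom (μ q γ x : ℝ) : ℝ :=
  ratio μ x * (ratio (μ + 1) x + (q + 1) / x - γ)

end BesselQuotient

end

namespace BesselQuotient

/-! Write `R` as `numer` over `denom`. The derivative of `numer` is `denom / r_μ` and the
logarithmic derivative of `denom` is L = r_{μ+1} + (q+1)/x - γ, so R' = 1/r_μ - R·L
(`R_hasDerivAt`). Setting R' = 0 gives (i). The quotient of the two derivatives is 1/(r_μ L), so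
L'Hôpital's rule turns both limits into asymptotics of Bessel ratios: r_a(x)/x → 1/(2(a+1)) at 0 and
r_a → 1 at infinity. Both rest on the three-term recurrence, the second also on r_a ≤ 1 for a ≥ 0.
If `R` somewhere exceeds both limits, it attains its maximum at an interior point, which is
stationary (`exists_stationaryPoint_ge`). Hence the supremum is finite and is the stated maximum. -/

/-- The entire function `∑ z^k / (k! Γ(k+a+1))`, with `I_a(x) = (x/2)^a besselSeries a (x²/4)`. -/
noncomputable def besselSeries (a z : ℝ) : ℝ :=
  ∑' k : ℕ, z ^ k / ((k.factorial : ℝ) * Real.Gamma ((k : ℝ) + a + 1))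

/-! ### The power series: derivative, recurrence, a quadratic inequality -/

section Series

variable {a : ℝ}

lemma add_add_one_pos (ha : -1 < a) (k : ℕ) : 0 < (k : ℝ) + a + 1 := by
  have : (0 : ℝ) ≤ k := k.cast_nonneg
  linarith

lemma besselSeries_coeff_pos (ha : -1 < a) (k : ℕ) :
    0 < (k.factorial : ℝ) * Real.Gamma ((k : ℝ) + a + 1) :=
  mul_pos (by exact_mod_cast k.factorial_pos) (Real.Gamma_pos_of_pos (add_add_one_pos ha k))

lemma besselSeries_coeff_succ (ha : -1 < a) (k : ℕ) :
    (((k + 1).factorial : ℕ) : ℝ) * Real.Gamma (((k + 1 : ℕ) : ℝ) + a + 1) =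
      ((k : ℝ) + 1) * ((k : ℝ) + a + 1) *
        ((k.factorial : ℝ) * Real.Gamma ((k : ℝ) + a + 1)) := by
  have h := Real.Gamma_add_one (add_add_one_pos ha k).ne'
  rw [show ((k + 1 : ℕ) : ℝ) + a + 1 = (k : ℝ) + a + 1 + 1 by push_cast; ring, h,
    Nat.factorial_succ]
  push_cast
  ring

lemma besselSeries_summable (ha : -1 < a) (z : ℝ) :
    Summable fun k : ℕ => z ^ k / ((k.factorial : ℝ) * Real.Gamma ((k : ℝ) + a + 1)) := by
  rcases eq_or_ne z 0 with rfl | hz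
  · refine summable_of_ne_finset_zero (s := {0}) fun k hk => ?_
    rw [zero_pow (by simpa using hk), zero_div]
  refine summable_of_ratio_test_tendsto_lt_one (l := 0) zero_lt_one
    (Eventually.of_forall fun k => div_ne_zero (pow_ne_zero _ hz)
      (besselSeries_coeff_pos ha k).ne') ?_
  have hlim : Tendsto (fun k : ℕ => |z| * ((((k : ℝ) + 1)⁻¹) * ((k : ℝ) + (a + 1))⁻¹)) atTop
      (𝓝 (|z| * (0 * 0))) := by
    refine Tendsto.const_mul _ (Tendsto.mul ?_ ?_)
    · exact tendsto_inv_atTop_zero.comp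
        (tendsto_atTop_add_const_right _ _ tendsto_natCast_atTop_atTop)
    · exact tendsto_inv_atTop_zero.comp
        (tendsto_atTop_add_const_right _ _ tendsto_natCast_atTop_atTop)
  rw [mul_zero, mul_zero] at hlim
  refine hlim.congr fun k => ?_
  have h1 := add_add_one_pos ha k
  have h2 := besselSeries_coeff_pos ha k
  have h3 : (0 : ℝ) < k + 1 := by positivity
  rw [besselSeries_coeff_succ ha, ← norm_div, Real.norm_eq_abs, ← add_assoc]
  have : z ^ (k + 1) / (((k : ℝ) + 1) * ((k : ℝ) + a + 1) *
        ((k.factorial : ℝ) * Real.Gamma ((k : ℝ) + a + 1))) /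
        (z ^ k / ((k.factorial : ℝ) * Real.Gamma ((k : ℝ) + a + 1))) =
      z * (((k : ℝ) + 1)⁻¹ * ((k : ℝ) + a + 1)⁻¹) := by
    rw [pow_succ]
    field_simp
  rw [this, abs_mul, abs_of_pos (a := ((k : ℝ) + 1)⁻¹ * _) (by positivity)]

lemma besselSeries_pos (ha : -1 < a) {z : ℝ} (hz : 0 ≤ z) : 0 < besselSeries a z := by
  refine (besselSeries_summable ha z).tsum_pos
    (fun k => div_nonneg (pow_nonneg hz k) (besselSeries_coeff_pos ha k).le) 0 ?_
  have := besselSeries_coeff_pos ha 0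
  rw [pow_zero]
  positivity

/-- Termwise derivative of `besselSeries a`. -/
lemma besselSeries_term_deriv (ha : -1 < a) (z : ℝ) (k : ℕ) :
    (((k + 1 : ℕ) : ℝ) * z ^ k) / (((k + 1).factorial : ℝ) *
        Real.Gamma (((k + 1 : ℕ) : ℝ) + a + 1)) =
      z ^ k / ((k.factorial : ℝ) * Real.Gamma ((k : ℝ) + (a + 1) + 1)) := by
  have h := besselSeries_coeff_pos (a := a + 1) (by linarith) k
  have h3 : (0 : ℝ) < k + 1 := by positivity
  rw [Nat.factorial_succ, show ((k + 1 : ℕ) : ℝ) + a + 1 = (k : ℝ) + (a + 1) + 1 by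
    push_cast; ring]
  push_cast
  rw [mul_assoc, mul_div_mul_left _ _ h3.ne']

lemma besselSeries_hasDerivAt (ha : -1 < a) (z : ℝ) :
    HasDerivAt (besselSeries a) (besselSeries (a + 1) z) z := by
  have ha' : -1 < a + 1 := by linarith
  set g : ℕ → ℝ → ℝ := fun k y =>
    y ^ k / ((k.factorial : ℝ) * Real.Gamma ((k : ℝ) + a + 1)) with hg
  -- At `k = 0` the exponent truncates to 0, but the factor `k` kills the term.
  set g' : ℕ → ℝ → ℝ := fun k y =>
    ((k : ℝ) * y ^ (k - 1)) / ((k.factorial : ℝ) * Real.Gamma ((k : ℝ) + a + 1)) with hg'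
  have hsucc : ∀ y k, g' (k + 1) y =
      y ^ k / ((k.factorial : ℝ) * Real.Gamma ((k : ℝ) + (a + 1) + 1)) := fun y k => by
    simpa [hg'] using besselSeries_term_deriv ha y k
  have hsum : ∀ y, Summable fun k => g' k y := fun y => by
    rw [← summable_nat_add_iff 1]
    simpa only [hsucc] using besselSeries_summable ha' y
  -- On the ball of radius |z| + 1 the derivative series is dominated by its own values at |z| + 1.
  have key := hasDerivAt_tsum_of_isPreconnected (g := g) (g' := g') (t := Metric.ball 0 (|z| + 1))
    (u := fun k => g' k (|z| + 1)) (y₀ := z) (y := z) (hsum _) Metric.isOpen_ball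
    (convex_ball _ _).isPreconnected (fun k y _ => (hasDerivAt_pow k y).div_const _) ?_
    (by simp) (besselSeries_summable ha z) (by simp)
  · have : ∑' k, g' k z = besselSeries (a + 1) z := by
      rw [(hsum z).tsum_eq_zero_add, besselSeries]
      simp only [hsucc]
      simp [hg']
    rw [this] at key
    exact key
  · intro k y hy
    have hy' : |y| ≤ |z| + 1 := by simpa using (Metric.mem_ball.1 hy).le
    have hc := besselSeries_coeff_pos ha k
    rw [Real.norm_eq_abs, abs_div, abs_of_pos hc, abs_mul, abs_pow, Nat.abs_cast]
    simp only [hg']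
    gcongr

lemma besselSeries_continuous (ha : -1 < a) : Continuous (besselSeries a) :=
  continuous_iff_continuousAt.2 fun z => (besselSeries_hasDerivAt ha z).continuousAt

/-- Γ(k+a+2) = (k+a+1) Γ(k+a+1); splitting k+a+1 into a+1 and k gives the two terms, the second
after an index shift. -/
lemma besselSeries_recurrence (ha : -1 < a) (z : ℝ) :
    besselSeries a z = (a + 1) * besselSeries (a + 1) z + z * besselSeries (a + 2) z := by
  have s0 := besselSeries_summable ha z
  have s1 := besselSeries_summable (a := a + 1) (by linarith) z
  have s2 := besselSeries_summable (a := a + 2) (by linarith) z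
  have h : ∀ k : ℕ, z ^ k / ((k.factorial : ℝ) * Real.Gamma ((k : ℝ) + a + 1)) =
      (a + 1) * (z ^ k / ((k.factorial : ℝ) * Real.Gamma ((k : ℝ) + (a + 1) + 1))) +
      (k : ℝ) * (z ^ k / ((k.factorial : ℝ) * Real.Gamma ((k : ℝ) + (a + 1) + 1))) := by
    intro k
    have h1 := add_add_one_pos ha k
    have h2 := besselSeries_coeff_pos ha k
    rw [show (k : ℝ) + (a + 1) + 1 = (k : ℝ) + a + 1 + 1 by ring, Real.Gamma_add_one h1.ne']
    have := Real.Gamma_pos_of_pos h1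
    field_simp
    ring
  have s3 : Summable fun k : ℕ =>
      (k : ℝ) * (z ^ k / ((k.factorial : ℝ) * Real.Gamma ((k : ℝ) + (a + 1) + 1))) := by
    refine (s0.sub (s1.mul_left (a + 1))).congr fun k => ?_
    rw [h k]
    ring
  have hshift : ∑' k : ℕ,
      (k : ℝ) * (z ^ k / ((k.factorial : ℝ) * Real.Gamma ((k : ℝ) + (a + 1) + 1))) =
      z * besselSeries (a + 2) z := by
    rw [s3.tsum_eq_zero_add, besselSeries, ← tsum_mul_left, Nat.cast_zero, zero_mul, zero_add]
    refine tsum_congr fun k => ?_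
    have := besselSeries_term_deriv (a := a + 1) (by linarith) z k
    rw [show a + 1 + 1 = a + 2 by ring] at this
    rw [← this]
    ring
  rw [← hshift]
  conv_lhs => rw [besselSeries]
  rw [tsum_congr h, (s1.mul_left (a + 1)).tsum_add s3, tsum_mul_left]
  rfl

/-- By the recurrence, the difference of the two sides has derivative (2a+1) F_{a+1}² ≥ 0, where F_a
is `besselSeries a`. This is I_{a+1} ≤ I_a in disguise. -/
lemma mul_sq_besselSeries_succ_le (ha : 0 ≤ a) {z : ℝ} (hz : 0 ≤ z) :
    z * besselSeries (a + 1) z ^ 2 ≤ besselSeries a z ^ 2 := by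
  have ha' : -1 < a := by linarith
  have hd : ∀ y, HasDerivAt (fun y => besselSeries a y ^ 2 - y * besselSeries (a + 1) y ^ 2)
      ((2 * a + 1) * besselSeries (a + 1) y ^ 2) y := by
    intro y
    have h0 := besselSeries_hasDerivAt ha' y
    have h1 := besselSeries_hasDerivAt (a := a + 1) (by linarith) y
    refine ((h0.pow 2).sub ((hasDerivAt_id y).mul (h1.pow 2))).congr_deriv ?_
    rw [besselSeries_recurrence ha' y, show a + 1 + 1 = a + 2 by ring]
    simp
    ring
  have hmono := monotone_of_hasDerivAt_nonneg hd fun y => by positivity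
  have h := hmono hz
  have : 0 ≤ besselSeries a 0 ^ 2 := by positivity
  simp only [zero_mul, sub_zero] at h
  linarith

end Series

/-! ### Bessel ratios and their limits at 0 and infinity -/

section Ratio

variable {a x : ℝ}

lemma besselI_eq (a : ℝ) (hx : 0 < x) :
    besselI a x = (x / 2) ^ a * besselSeries a (x ^ 2 / 4) := by
  rw [besselI, besselSeries, ← tsum_mul_left]
  refine tsum_congr fun k => ?_
  rw [Real.rpow_add (by positivity), show (2 * (k : ℝ)) = ((2 * k : ℕ) : ℝ) by push_cast; ring,
    Real.rpow_natCast, pow_mul, show (x / 2) ^ 2 = x ^ 2 / 4 by ring]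
  ring

lemma ratio_eq (a : ℝ) (hx : 0 < x) :
    ratio a x = x / 2 * (besselSeries (a + 1) (x ^ 2 / 4) / besselSeries a (x ^ 2 / 4)) := by
  have : 0 < (x / 2) ^ a := by positivity
  rw [ratio, besselI_eq _ hx, besselI_eq _ hx, Real.rpow_add_one (by positivity), mul_assoc,
    mul_div_mul_left _ _ this.ne', mul_div_assoc]

lemma ratio_pos (ha : -1 < a) (hx : 0 < x) : 0 < ratio a x := by
  have h0 := besselSeries_pos ha (z := x ^ 2 / 4) (by positivity)
  have h1 := besselSeries_pos (a := a + 1) (by linarith) (z := x ^ 2 / 4) (by positivity)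
  rw [ratio_eq a hx]
  positivity

lemma ratio_eq_inv (ha : -1 < a) (hx : 0 < x) :
    ratio a x = (2 * (a + 1) / x + ratio (a + 1) x)⁻¹ := by
  have h0 := besselSeries_pos ha (z := x ^ 2 / 4) (by positivity)
  have h1 := besselSeries_pos (a := a + 1) (by linarith) (z := x ^ 2 / 4) (by positivity)
  refine eq_inv_of_mul_eq_one_left ?_
  rw [ratio_eq a hx, ratio_eq _ hx, show a + 1 + 1 = a + 2 by ring]
  have h := besselSeries_recurrence ha (x ^ 2 / 4)
  field_simp
  rw [h]
  ring

lemma ratio_le_one (ha : 0 ≤ a) (hx : 0 < x) : ratio a x ≤ 1 := by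
  have h0 := besselSeries_pos (by linarith : -1 < a) (z := x ^ 2 / 4) (by positivity)
  have h := mul_sq_besselSeries_succ_le ha (z := x ^ 2 / 4) (by positivity)
  rw [ratio_eq a hx, ← mul_div_assoc, div_le_one h0]
  refine le_of_sq_le_sq ?_ h0.le
  calc _ = _ := by ring
    _ ≤ _ := h

lemma tendsto_const_div_atTop_zero (c : ℝ) : Tendsto (fun x : ℝ => c / x) atTop (𝓝 0) :=
  tendsto_id.const_div_atTop c

/-- Inserting r_{a+1} ≤ 1 into the recurrence bounds r_a below; r_a ≤ 1 closes the squeeze. -/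
lemma tendsto_ratio_atTop_of_nonneg (ha : 0 ≤ a) : Tendsto (ratio a) atTop (𝓝 1) := by
  have hlow : Tendsto (fun x : ℝ => (2 * (a + 1) / x + 1)⁻¹) atTop (𝓝 1) := by
    simpa using ((tendsto_const_div_atTop_zero (2 * (a + 1))).add_const 1).inv₀ (by norm_num)
  refine tendsto_of_tendsto_of_tendsto_of_le_of_le' hlow tendsto_const_nhds ?_ ?_
  · filter_upwards [eventually_gt_atTop 0] with x hx
    rw [ratio_eq_inv (by linarith) hx]
    have := ratio_pos (a := a + 1) (by linarith) hx
    have := ratio_le_one (a := a + 1) (by linarith) hx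
    gcongr
  · filter_upwards [eventually_gt_atTop 0] with x hx using ratio_le_one ha hx

/-- One use of the recurrence moves the index to a+1 > 0. -/
lemma tendsto_ratio_atTop (ha : -1 < a) : Tendsto (ratio a) atTop (𝓝 1) := by
  have h := ((tendsto_const_div_atTop_zero (2 * (a + 1))).add
    (tendsto_ratio_atTop_of_nonneg (a := a + 1) (by linarith))).inv₀ (by norm_num)
  rw [zero_add, inv_one] at h
  refine h.congr' ?_
  filter_upwards [eventually_gt_atTop 0] with x hx using (ratio_eq_inv ha hx).symm

lemma tendsto_ratio_div_zero (ha : -1 < a) :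
    Tendsto (fun x => ratio a x / x) (𝓝[>] 0) (𝓝 (2 * (a + 1))⁻¹) := by
  have ha' : -1 < a + 1 := by linarith
  have h0 := besselSeries_pos ha le_rfl
  have hc : Continuous fun x : ℝ => x ^ 2 / 4 := by fun_prop
  have h : ContinuousAt (fun x : ℝ => 1 / 2 * (besselSeries (a + 1) (x ^ 2 / 4) /
      besselSeries a (x ^ 2 / 4))) 0 := by
    refine continuousAt_const.mul (ContinuousAt.div ?_ ?_ ?_)
    · exact ((besselSeries_continuous ha').comp hc).continuousAt
    · exact ((besselSeries_continuous ha).comp hc).continuousAt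
    · simpa using h0.ne'
  have hval : 1 / 2 * (besselSeries (a + 1) ((0 : ℝ) ^ 2 / 4) /
      besselSeries a ((0 : ℝ) ^ 2 / 4)) = (2 * (a + 1))⁻¹ := by
    have hr := besselSeries_recurrence ha 0
    have h1 := besselSeries_pos ha' le_rfl
    have h2 : 0 < a + 1 := by linarith
    norm_num only
    rw [hr]
    field_simp
    ring
  have ht := h.tendsto
  rw [hval] at ht
  refine (ht.mono_left nhdsWithin_le_nhds).congr' ?_
  filter_upwards [self_mem_nhdsWithin] with x hx
  have hx' : x ≠ 0 := ne_of_gt hx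
  rw [ratio_eq a hx]
  field_simp

lemma tendsto_ratio_zero (ha : -1 < a) : Tendsto (ratio a) (𝓝[>] 0) (𝓝 0) := by
  have h := (tendsto_ratio_div_zero ha).mul
    ((tendsto_id (α := ℝ) (x := 𝓝 0)).mono_left nhdsWithin_le_nhds)
  rw [mul_zero] at h
  refine h.congr' ?_
  filter_upwards [self_mem_nhdsWithin] with x hx
  exact div_mul_cancel₀ _ (ne_of_gt hx)

end Ratio

/-! ### L'Hôpital at infinity and maxima on the half-line -/

section Calculus

variable {f g f' g' : ℝ → ℝ} {l : ℝ}

/-- Eventually f - c g is antitone, so f ≤ c g + const, and the constant is absorbed by (d - c) g as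
g grows. -/
lemma eventually_div_lt_of_deriv_le {c d : ℝ} (hf : ∀ᶠ x in atTop, HasDerivAt f (f' x) x)
    (hg : ∀ᶠ x in atTop, HasDerivAt g (g' x) x) (hle : ∀ᶠ x in atTop, f' x ≤ c * g' x)
    (hgtop : Tendsto g atTop atTop) (hcd : c < d) : ∀ᶠ x in atTop, f x / g x < d := by
  obtain ⟨X, hX⟩ := eventually_atTop.1 (hf.and (hg.and hle))
  have hd : ∀ x ≥ X, HasDerivAt (fun x => f x - c * g x) (f' x - c * g' x) x := fun x hx =>
    (hX x hx).1.sub ((hX x hx).2.1.const_mul c)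
  have hanti : AntitoneOn (fun x => f x - c * g x) (Ici X) := by
    refine antitoneOn_of_hasDerivWithinAt_nonpos (convex_Ici X)
      (fun x hx => (hd x hx).continuousAt.continuousWithinAt)
      (fun x hx => (hd x (interior_subset hx)).hasDerivWithinAt) fun x hx => ?_
    have := (hX x (interior_subset hx)).2.2
    linarith
  filter_upwards [eventually_ge_atTop X, hgtop.eventually_gt_atTop 0,
    hgtop.eventually_gt_atTop ((f X - c * g X) / (d - c))] with x hx h0 hC
  have h := hanti self_mem_Ici hx hx
  rw [div_lt_iff₀ (sub_pos.2 hcd)] at hC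
  rw [div_lt_iff₀ h0]
  simp only at h
  linarith

/-- L'Hôpital's rule at infinity when the denominator tends to infinity. -/
lemma lhopital_atTop_of_tendsto_atTop (hf : ∀ᶠ x in atTop, HasDerivAt f (f' x) x)
    (hg : ∀ᶠ x in atTop, HasDerivAt g (g' x) x) (hg' : ∀ᶠ x in atTop, 0 < g' x)
    (hgtop : Tendsto g atTop atTop) (hl : Tendsto (fun x => f' x / g' x) atTop (𝓝 l)) :
    Tendsto (fun x => f x / g x) atTop (𝓝 l) := by
  refine tendsto_order.2 ⟨fun b hb => ?_, fun b hb => ?_⟩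
  · obtain ⟨c, hbc, hcl⟩ := exists_between hb
    have h := eventually_div_lt_of_deriv_le (c := -c) (d := -b) (hf.mono fun x hx => hx.neg) hg ?_
      hgtop (neg_lt_neg hbc)
    · filter_upwards [h] with x hx
      rw [Pi.neg_apply, neg_div] at hx
      exact neg_lt_neg_iff.1 hx
    · filter_upwards [hg', hl.eventually_const_lt hcl] with x h0 hx
      rw [lt_div_iff₀ h0] at hx
      linarith
  · obtain ⟨c, hlc, hcb⟩ := exists_between hb
    refine eventually_div_lt_of_deriv_le hf hg ?_ hgtop hcb
    filter_upwards [hg', hl.eventually_lt_const hlc] with x h0 hx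
    rw [div_lt_iff₀ h0] at hx
    exact hx.le

/-- Since log g - c x is eventually monotone, g grows at least exponentially. -/
lemma tendsto_atTop_of_logDeriv {c : ℝ} (hc : 0 < c) (hg : ∀ᶠ x in atTop, HasDerivAt g (g' x) x)
    (hpos : ∀ᶠ x in atTop, 0 < g x) (hle : ∀ᶠ x in atTop, c * g x ≤ g' x) :
    Tendsto g atTop atTop := by
  obtain ⟨X, hX⟩ := eventually_atTop.1 (hg.and (hpos.and hle))
  have hlog : ∀ x ≥ X, HasDerivAt (fun x => Real.log (g x) - c * x) (g' x / g x - c * 1) x :=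
    fun x hx => ((hX x hx).1.log (hX x hx).2.1.ne').sub ((hasDerivAt_id x).const_mul c)
  have hmono : MonotoneOn (fun x => Real.log (g x) - c * x) (Ici X) := by
    refine monotoneOn_of_hasDerivWithinAt_nonneg (convex_Ici X)
      (fun x hx => (hlog x hx).continuousAt.continuousWithinAt)
      (fun x hx => (hlog x (interior_subset hx)).hasDerivWithinAt) fun x hx => ?_
    obtain ⟨-, h1, h2⟩ := hX x (interior_subset hx)
    rw [mul_one, sub_nonneg, le_div_iff₀ h1]
    exact h2
  have htop : Tendsto (fun x => Real.exp (c * x + (Real.log (g X) - c * X))) atTop atTop :=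
    Real.tendsto_exp_atTop.comp
      (tendsto_atTop_add_const_right _ _ (tendsto_id.const_mul_atTop hc))
  refine tendsto_atTop_mono' _ ?_ htop
  filter_upwards [eventually_ge_atTop X] with x hx
  have h := hmono self_mem_Ici hx hx
  rw [← Real.le_log_iff_exp_le (hX x hx).2.1]
  simp only at h
  linarith

/-- A function on the open half-line which somewhere exceeds its limits at both ends attains its
maximum. -/
lemma exists_isMaxOn_Ioi {f : ℝ → ℝ} {l m x : ℝ} (hf : ContinuousOn f (Ioi 0))
    (h0 : Tendsto f (𝓝[>] 0) (𝓝 l)) (htop : Tendsto f atTop (𝓝 m)) (hx : 0 < x) (hl : l < f x)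
    (hm : m < f x) : ∃ y ∈ Ioi (0 : ℝ), IsMaxOn f (Ioi 0) y := by
  obtain ⟨u, hu, hu'⟩ := mem_nhdsGT_iff_exists_Ioo_subset.1 (h0.eventually_lt_const hl)
  obtain ⟨v, hv⟩ := eventually_atTop.1 (htop.eventually_lt_const hm)
  have hu0 : 0 < u := hu
  have hxu : min u x ≤ x := min_le_right _ _
  have hxv : x ≤ max v x := le_max_right _ _
  have hpos : 0 < min u x := lt_min hu0 hx
  -- Outside this interval f exceeds neither f x nor, therefore, the maximum over the interval,
  -- which contains x.
  obtain ⟨y, hy, hmax⟩ := isCompact_Icc.exists_isMaxOn (s := Icc (min u x) (max v x))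
    ⟨x, hxu, hxv⟩ (hf.mono fun z hz => hpos.trans_le hz.1)
  refine ⟨y, hpos.trans_le hy.1, fun z hz => ?_⟩
  have hxy : f x ≤ f y := hmax ⟨hxu, hxv⟩
  rcases lt_or_ge z (min u x) with h | h
  · have : f z < f x := hu' ⟨hz, h.trans_le (min_le_left _ _)⟩
    exact (this.trans_le hxy).le
  rcases lt_or_ge (max v x) z with h' | h'
  · exact ((hv z ((le_max_left _ _).trans h'.le)).trans_le hxy).le
  · exact hmax ⟨h, h'⟩

lemma bddAbove_image_Ioi {f : ℝ → ℝ} {l m : ℝ} (hf : ContinuousOn f (Ioi 0))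
    (h0 : Tendsto f (𝓝[>] 0) (𝓝 l)) (htop : Tendsto f atTop (𝓝 m)) :
    BddAbove (f '' Ioi 0) := by
  by_cases h : ∃ x, 0 < x ∧ max l m < f x
  · obtain ⟨x, hx, hlm⟩ := h
    obtain ⟨y, -, hy⟩ := exists_isMaxOn_Ioi hf h0 htop hx ((le_max_left _ _).trans_lt hlm)
      ((le_max_right _ _).trans_lt hlm)
    exact ⟨f y, forall_mem_image.2 hy⟩
  · push Not at h
    exact ⟨max l m, forall_mem_image.2 h⟩

lemma limits_le_sSup_image_Ioi {f : ℝ → ℝ} {l m : ℝ} (hb : BddAbove (f '' Ioi 0))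
    (h0 : Tendsto f (𝓝[>] 0) (𝓝 l)) (htop : Tendsto f atTop (𝓝 m)) :
    max l m ≤ sSup (f '' Ioi 0) := by
  refine max_le (le_of_tendsto h0 ?_) (le_of_tendsto htop ?_)
  · filter_upwards [self_mem_nhdsWithin] with x hx using le_csSup hb (mem_image_of_mem f hx)
  · filter_upwards [eventually_gt_atTop 0] with x hx using le_csSup hb (mem_image_of_mem f hx)

end Calculus

/-! ### Numerator, denominator and the quotient `R` -/

section Quotient

variable {μ q γ x : ℝ}

/-- The numerator of `R`. -/
noncomputable def numer (μ q γ x : ℝ) : ℝ :=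
  ∫ t in (0 : ℝ)..x, Real.exp (-γ * t) * t ^ (q - μ) * besselI μ t

/-- The denominator of `R`. -/
noncomputable def denom (μ q γ x : ℝ) : ℝ :=
  Real.exp (-γ * x) * x ^ (q - μ) * besselI (μ + 1) x

/-- Isolates the power singularity at 0: t^q, integrable, for a = μ, and x^(q+1), vanishing at 0,
for a = μ + 1. -/
lemma weight_mul_besselI (μ q γ : ℝ) (a : ℝ) (hx : 0 < x) :
    Real.exp (-γ * x) * x ^ (q - μ) * besselI a x =
      ((2 ^ a)⁻¹ * (Real.exp (-γ * x) * besselSeries a (x ^ 2 / 4))) * x ^ (q - μ + a) := by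
  rw [besselI_eq _ hx, Real.div_rpow hx.le zero_le_two, Real.rpow_add hx]
  ring

lemma continuous_exp_mul_besselSeries (hμ : -1 < μ) (γ c : ℝ) :
    Continuous fun x => c * (Real.exp (-γ * x) * besselSeries μ (x ^ 2 / 4)) := by
  have := besselSeries_continuous hμ
  fun_prop

lemma intervalIntegrable_weight (hμ : -1 < μ) (hq : -1 < q) (γ : ℝ) (hx : 0 ≤ x) :
    IntervalIntegrable (fun t => Real.exp (-γ * t) * t ^ (q - μ) * besselI μ t)
      MeasureTheory.volume 0 x := by
  have h := (intervalIntegral.intervalIntegrable_rpow' hq (a := 0) (b := x)).continuousOn_mul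
    (continuous_exp_mul_besselSeries hμ γ (2 ^ μ)⁻¹).continuousOn
  refine h.congr fun t ht => ?_
  rw [uIoc_of_le hx] at ht
  rw [weight_mul_besselI μ q γ μ ht.1, sub_add_cancel]

lemma continuousOn_weight (hμ : -1 < μ) (q γ : ℝ) :
    ContinuousOn (fun t => Real.exp (-γ * t) * t ^ (q - μ) * besselI μ t) (Ioi 0) := by
  have h : ContinuousOn (fun t : ℝ => t ^ (q - μ + μ)) (Ioi 0) := fun t ht =>
    (Real.continuousAt_rpow_const t _ (Or.inl (ne_of_gt ht))).continuousWithinAt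
  exact ((continuous_exp_mul_besselSeries hμ γ (2 ^ μ)⁻¹).continuousOn.mul h).congr
    fun t ht => weight_mul_besselI μ q γ μ ht

lemma numer_hasDerivAt (hμ : -1 < μ) (hq : -1 < q) (γ : ℝ) (hx : 0 < x) :
    HasDerivAt (numer μ q γ) (Real.exp (-γ * x) * x ^ (q - μ) * besselI μ x) x := by
  have hc := continuousOn_weight hμ q γ
  exact intervalIntegral.integral_hasDerivAt_right (intervalIntegrable_weight hμ hq γ hx.le)
    (hc.stronglyMeasurableAtFilter isOpen_Ioi x hx) (hc.continuousAt (Ioi_mem_nhds hx))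

lemma tendsto_numer_zero (hμ : -1 < μ) (hq : -1 < q) (γ : ℝ) :
    Tendsto (numer μ q γ) (𝓝[>] 0) (𝓝 0) := by
  have hint := intervalIntegrable_weight hμ hq γ zero_le_one
  have h := intervalIntegral.continuousOn_primitive_interval
    (f := fun t => Real.exp (-γ * t) * t ^ (q - μ) * besselI μ t) (a := 0) (b := 1)
    (μ := MeasureTheory.volume) (by
      rw [uIcc_of_le zero_le_one]
      exact (intervalIntegrable_iff_integrableOn_Icc_of_le zero_le_one).1 hint)
  have h0 := (h 0 left_mem_uIcc).tendsto
  rw [intervalIntegral.integral_same, uIcc_of_le zero_le_one] at h0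
  refine h0.mono_left ?_
  rw [← nhdsWithin_Ioo_eq_nhdsGT (zero_lt_one' ℝ)]
  exact nhdsWithin_mono _ Ioo_subset_Icc_self

lemma denom_eq (μ q γ : ℝ) (hx : 0 < x) :
    denom μ q γ x = ((2 ^ (μ + 1))⁻¹ *
      (Real.exp (-γ * x) * besselSeries (μ + 1) (x ^ 2 / 4))) * x ^ (q + 1) := by
  rw [denom, weight_mul_besselI μ q γ (μ + 1) hx, show q - μ + (μ + 1) = q + 1 by ring]

lemma besselI_pos (hμ : -1 < μ) (hx : 0 < x) : 0 < besselI μ x := by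
  have := besselSeries_pos hμ (z := x ^ 2 / 4) (by positivity)
  rw [besselI_eq μ hx]
  positivity

lemma denom_pos (hμ : -1 < μ) (q γ : ℝ) (hx : 0 < x) : 0 < denom μ q γ x := by
  have := besselI_pos (μ := μ + 1) (by linarith) hx
  rw [denom]
  positivity

lemma denom_hasDerivAt (hμ : -1 < μ) (q γ : ℝ) (hx : 0 < x) :
    HasDerivAt (denom μ q γ) (denom μ q γ x * (ratio (μ + 1) x + (q + 1) / x - γ)) x := by
  have hμ' : -1 < μ + 1 := by linarith
  have hS := besselSeries_pos hμ' (z := x ^ 2 / 4) (by positivity)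
  have h1 : HasDerivAt (fun x : ℝ => x ^ 2 / 4) (x / 2) x :=
    ((hasDerivAt_pow 2 x).div_const 4).congr_deriv (by norm_num; ring)
  have h2 := (besselSeries_hasDerivAt hμ' (x ^ 2 / 4)).comp x h1
  have h3 : HasDerivAt (fun x : ℝ => Real.exp (-γ * x)) (Real.exp (-γ * x) * (-γ * 1)) x :=
    ((hasDerivAt_id x).const_mul (-γ)).exp
  have h4 := Real.hasDerivAt_rpow_const (x := x) (p := q + 1) (Or.inl hx.ne')
  have h := ((h3.mul h2).const_mul (2 ^ (μ + 1))⁻¹).mul h4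
  refine (h.congr_deriv ?_).congr_of_eventuallyEq ?_
  · rw [denom_eq μ q γ hx, ratio_eq _ hx, Real.rpow_sub_one hx.ne']
    simp only [Pi.mul_apply, Function.comp_apply]
    field_simp
    ring
  · filter_upwards [Ioi_mem_nhds hx] with y hy
    rw [denom_eq μ q γ hy]
    rfl

lemma tendsto_denom_zero (hμ : -1 < μ) (hq : -1 < q) (γ : ℝ) :
    Tendsto (denom μ q γ) (𝓝[>] 0) (𝓝 0) := by
  have h1 := (continuous_exp_mul_besselSeries (μ := μ + 1) (by linarith) γ
    (2 ^ (μ + 1))⁻¹).tendsto 0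
  have h2 := (Real.continuousAt_rpow_const 0 (q + 1) (Or.inr (by linarith))).tendsto
  have h := h1.mul h2
  rw [Real.zero_rpow (by linarith), mul_zero] at h
  refine (h.mono_left nhdsWithin_le_nhds).congr' ?_
  filter_upwards [self_mem_nhdsWithin] with x hx using (denom_eq μ q γ hx).symm

lemma weight_eq_denom_div_ratio (hμ : -1 < μ) (q γ : ℝ) (hx : 0 < x) :
    Real.exp (-γ * x) * x ^ (q - μ) * besselI μ x = denom μ q γ x / ratio μ x := by
  have h0 := besselI_pos hμ hx
  have h1 := besselI_pos (μ := μ + 1) (by linarith) hx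
  rw [denom, ratio]
  field_simp

/-- The quotient of the derivatives of numerator and denominator. -/
lemma deriv_numer_div_deriv_denom (hμ : -1 < μ) (q γ : ℝ) (hx : 0 < x) :
    (Real.exp (-γ * x) * x ^ (q - μ) * besselI μ x) /
      (denom μ q γ x * (ratio (μ + 1) x + (q + 1) / x - γ)) = 1 / stationaryDenom μ q γ x := by
  have hd := denom_pos hμ q γ hx
  rw [weight_eq_denom_div_ratio hμ q γ hx, stationaryDenom, div_div, mul_left_comm,
    ← div_div, div_self hd.ne']

lemma R_hasDerivAt (hμ : -1 < μ) (hq : -1 < q) (γ : ℝ) (hx : 0 < x) :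
    HasDerivAt (R μ q γ)
      (1 / ratio μ x - R μ q γ x * (ratio (μ + 1) x + (q + 1) / x - γ)) x := by
  have hd := denom_pos hμ q γ hx
  have hr := ratio_pos hμ hx
  refine ((numer_hasDerivAt hμ hq γ hx).div (denom_hasDerivAt hμ q γ hx) hd.ne').congr_deriv ?_
  rw [weight_eq_denom_div_ratio hμ q γ hx, show R μ q γ x = numer μ q γ x / denom μ q γ x from rfl]
  field_simp

lemma stationary_value (hμ : -1 < μ) (hq : -1 < q) (hx : x ∈ stationaryPoints μ q γ) :
    stationaryDenom μ q γ x ≠ 0 ∧ R μ q γ x = 1 / stationaryDenom μ q γ x := by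
  obtain ⟨hx0, hx'⟩ := hx
  have h := (R_hasDerivAt hμ hq γ hx0).unique hx'
  have hr := ratio_pos hμ hx0
  have h1 : R μ q γ x * stationaryDenom μ q γ x = 1 := by
    rw [stationaryDenom, mul_left_comm, ← sub_eq_zero.1 h, mul_one_div_cancel hr.ne']
  exact ⟨right_ne_zero_of_mul_eq_one h1, eq_one_div_of_mul_eq_one_left h1⟩

lemma tendsto_R_zero (hμ : -1 < μ) (hq : -1 < q) (γ : ℝ) :
    Tendsto (R μ q γ) (𝓝[>] 0) (𝓝 (2 * (μ + 1) / (q + 1))) := by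
  have hpos : ∀ᶠ x : ℝ in 𝓝[>] 0, 0 < x := self_mem_nhdsWithin
  have hμ1 : 0 < μ + 1 := by linarith
  have hq1 : 0 < q + 1 := by linarith
  have hden : Tendsto (stationaryDenom μ q γ) (𝓝[>] 0) (𝓝 ((q + 1) / (2 * (μ + 1)))) := by
    -- The singular (q+1)/x is paired with r_μ, since r_μ(x)/x has a finite limit.
    have h1 := (tendsto_ratio_zero hμ).mul
      ((tendsto_ratio_zero (a := μ + 1) (by linarith)).sub_const γ)
    have h := h1.add ((tendsto_ratio_div_zero hμ).mul_const (q + 1))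
    rw [zero_mul, zero_add, inv_mul_eq_div] at h
    refine h.congr fun x => ?_
    rw [stationaryDenom]
    ring
  have hne : (q + 1) / (2 * (μ + 1)) ≠ 0 := by positivity
  refine HasDerivAt.lhopital_zero_nhdsGT
    (hpos.mono fun x hx => numer_hasDerivAt hμ hq γ hx)
    (hpos.mono fun x hx => denom_hasDerivAt hμ q γ hx) ?_
    (tendsto_numer_zero hμ hq γ) (tendsto_denom_zero hμ hq γ) ?_
  · filter_upwards [hpos, hden.eventually_ne hne] with x hx h
    exact mul_ne_zero (denom_pos hμ q γ hx).ne' (right_ne_zero_of_mul h)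
  · have h := hden.inv₀ hne
    simp only [inv_div, ← one_div (stationaryDenom _ _ _ _)] at h
    exact h.congr' (hpos.mono fun x hx => (deriv_numer_div_deriv_denom hμ q γ hx).symm)

lemma tendsto_R_atTop (hμ : -1 < μ) (hq : -1 < q) (hγ : γ < 1) :
    Tendsto (R μ q γ) atTop (𝓝 (1 / (1 - γ))) := by
  have hpos : ∀ᶠ x : ℝ in atTop, 0 < x := eventually_gt_atTop 0
  have hlog : Tendsto (fun x => ratio (μ + 1) x + (q + 1) / x - γ) atTop (𝓝 (1 - γ)) := by
    simpa using ((tendsto_ratio_atTop (a := μ + 1) (by linarith)).add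
      (tendsto_const_div_atTop_zero (q + 1))).sub_const γ
  have hγ' : 0 < 1 - γ := sub_pos.2 hγ
  have hden : Tendsto (stationaryDenom μ q γ) atTop (𝓝 (1 - γ)) := by
    have h := (tendsto_ratio_atTop hμ).mul hlog
    rwa [one_mul] at h
  have hderiv : ∀ᶠ x in atTop, HasDerivAt (denom μ q γ)
      (denom μ q γ x * (ratio (μ + 1) x + (q + 1) / x - γ)) x :=
    hpos.mono fun x hx => denom_hasDerivAt hμ q γ hx
  refine lhopital_atTop_of_tendsto_atTop
    (hpos.mono fun x hx => numer_hasDerivAt hμ hq γ hx) hderiv ?_ ?_ ?_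
  · filter_upwards [hpos, hlog.eventually_const_lt hγ'] with x hx h
    exact mul_pos (denom_pos hμ q γ hx) h
  -- The logarithmic derivative of `denom` tends to 1 - γ > 0, so it eventually exceeds half of
  -- that.
  · refine tendsto_atTop_of_logDeriv (half_pos hγ') hderiv
      (hpos.mono fun x hx => denom_pos hμ q γ hx) ?_
    filter_upwards [hpos, hlog.eventually_const_lt (half_lt_self hγ')] with x hx h
    rw [mul_comm]
    exact mul_le_mul_of_nonneg_left h.le (denom_pos hμ q γ hx).le
  · exact (tendsto_const_nhds.div hden hγ'.ne').congr'
      (hpos.mono fun x hx => (deriv_numer_div_deriv_denom hμ q γ hx).symm)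

lemma R_continuousOn (hμ : -1 < μ) (hq : -1 < q) (γ : ℝ) : ContinuousOn (R μ q γ) (Ioi 0) :=
  fun _ hx => (R_hasDerivAt hμ hq γ hx).continuousAt.continuousWithinAt

lemma R_bddAbove (hμ : -1 < μ) (hq : -1 < q) (hγ : γ < 1) : BddAbove (R μ q γ '' Ioi 0) :=
  bddAbove_image_Ioi (R_continuousOn hμ hq γ) (tendsto_R_zero hμ hq γ) (tendsto_R_atTop hμ hq hγ)

/-- A value of `R` above both endpoint limits is dominated by a value at a stationary point. -/
lemma exists_stationaryPoint_ge (hμ : -1 < μ) (hq : -1 < q) (hγ : γ < 1) (hx : 0 < x)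
    (h : max (2 * (μ + 1) / (q + 1)) (1 / (1 - γ)) < R μ q γ x) :
    ∃ y ∈ stationaryPoints μ q γ, R μ q γ x ≤ R μ q γ y := by
  obtain ⟨y, hy, hmax⟩ := exists_isMaxOn_Ioi (R_continuousOn hμ hq γ) (tendsto_R_zero hμ hq γ)
    (tendsto_R_atTop hμ hq hγ) hx ((le_max_left _ _).trans_lt h) ((le_max_right _ _).trans_lt h)
  have hd := R_hasDerivAt hμ hq γ hy
  have h0 := (hmax.isLocalMax (Ioi_mem_nhds hy)).hasDerivAt_eq_zero hd
  exact ⟨y, ⟨hy, h0 ▸ hd⟩, hmax hx⟩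

lemma image_stationaryDenom_eq (hμ : -1 < μ) (hq : -1 < q) (γ : ℝ) :
    (fun x => 1 / stationaryDenom μ q γ x) '' stationaryPoints μ q γ =
      R μ q γ '' stationaryPoints μ q γ :=
  image_congr fun _ hx => (stationary_value hμ hq hx).2.symm

end Quotient

end BesselQuotient

theorem mainTheorem9 (μ q γ : ℝ) (hμ : -1 < μ) (hq : -1 < q) (hγ0 : 0 < γ) (hγ1 : γ < 1) :
    (∀ x₀ ∈ BesselQuotient.stationaryPoints μ q γ,
      BesselQuotient.stationaryDenom μ q γ x₀ ≠ 0 ∧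
      BesselQuotient.R μ q γ x₀ = 1 / BesselQuotient.stationaryDenom μ q γ x₀) ∧
    Tendsto (BesselQuotient.R μ q γ) (𝓝[>] 0) (𝓝 (2 * (μ + 1) / (q + 1))) ∧
    Tendsto (BesselQuotient.R μ q γ) atTop (𝓝 (1 / (1 - γ))) ∧
    BddAbove (BesselQuotient.R μ q γ '' Ioi 0) ∧
    ((BesselQuotient.stationaryPoints μ q γ).Nonempty →
      BddAbove ((fun x => 1 / BesselQuotient.stationaryDenom μ q γ x) ''
        BesselQuotient.stationaryPoints μ q γ) ∧
      BesselQuotient.sharpConstant μ q γ =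
        max (max (2 * (μ + 1) / (q + 1)) (1 / (1 - γ)))
          (sSup ((fun x => 1 / BesselQuotient.stationaryDenom μ q γ x) ''
            BesselQuotient.stationaryPoints μ q γ))) ∧
    (BesselQuotient.stationaryPoints μ q γ = ∅ →
      BesselQuotient.sharpConstant μ q γ = max (2 * (μ + 1) / (q + 1)) (1 / (1 - γ))) := by
  have h0 := BesselQuotient.tendsto_R_zero hμ hq γ
  have htop := BesselQuotient.tendsto_R_atTop hμ hq hγ1
  have hb := BesselQuotient.R_bddAbove hμ hq hγ1
  have hlim := BesselQuotient.limits_le_sSup_image_Ioi hb h0 htop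
  have hne : (BesselQuotient.R μ q γ '' Ioi 0).Nonempty := nonempty_Ioi.image _
  refine ⟨fun x₀ hx₀ => BesselQuotient.stationary_value hμ hq hx₀, h0, htop, hb,
    fun hS => ?_, fun hS => ?_⟩
  · rw [BesselQuotient.image_stationaryDenom_eq hμ hq γ]
    have hsub : BesselQuotient.R μ q γ '' BesselQuotient.stationaryPoints μ q γ ⊆
        BesselQuotient.R μ q γ '' Ioi 0 := image_mono fun _ hx => hx.1
    have hb' := hb.mono hsub
    refine ⟨hb', le_antisymm (csSup_le hne (forall_mem_image.2 fun x hx => ?_))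
      (max_le hlim (csSup_le_csSup hb (hS.image _) hsub))⟩
    by_contra! h
    obtain ⟨y, hy, hxy⟩ := BesselQuotient.exists_stationaryPoint_ge hμ hq hγ1 hx
      ((le_max_left _ _).trans_lt h)
    exact absurd (hxy.trans (le_csSup hb' (mem_image_of_mem _ hy)))
      (not_le.2 ((le_max_right _ _).trans_lt h))
  · refine le_antisymm (csSup_le hne (forall_mem_image.2 fun x hx => ?_)) hlim
    by_contra! h
    obtain ⟨y, hy, -⟩ := BesselQuotient.exists_stationaryPoint_ge hμ hq hγ1 hx h
    rw [hS] at hy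
    exact hy
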